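/- Let $\mathcal T=(\mathcal V,\mathcal E)$ be a finite directed multigraph (parallel links allowed); for a node $v$ let $\mathcal E_v^+$ and $\mathcal E_v^-$ be the sets of its outgoing and incoming links. Assume that $\mathcal T$ contains no directed cycle, has a unique origin $o$ (node with $\mathcal E_o^-=\emptyset$) and a unique destination $d$ (node with $\mathcal E_d^+=\emptyset$), and that $d$ can be reached by a directed path from every other node. For every link $e$ let $\mu_e:\mathbb R_+\to\mathbb R_+$ (with $\mathbb R_+=[0,\infty)$) be continuously differentiable and strictly increasing, with bounded derivative, $\mu_e(0)=0$ and $f_e^{\max}:=\sup_{x\ge0}\mu_e(x)<+\infty$. Put $\mathcal F:=\prod_{e\in\mathcal E}[0,f_e^{\max})$, and let $\mathrm{cl}(\mathcal F)$ be its closure in $\mathbb R^{\mathcal E}$. For a finite set $\mathcal J$ let $\mathcal S_{\mathcal J}:=\{p\in\mathbb R_+^{\mathcal J}:\sum_{j\in\mathcal J}p_j=1\}$. Let $G$ be a locally responsive distributed routing policy, that is, a family of continuously differentiable maps $G^v:\mathbb R_+^{\mathcal E_v^+}\to\mathcal S_{\mathcal E_v^+}$, one for each node $v\ne d$, such that for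 every $v\neq d$: (a) $\partial G^v_j(\rho^v)/\partial\rho_e\ge 0$ for all $j\ne e$ in $\mathcal E_v^+$ and all $\rho^v\in\mathbb R_+^{\mathcal E_v^+}$; (b) for every nonempty proper subset $\mathcal J\subsetneq\mathcal E_v^+$ there is a continuously differentiable map $G^{\mathcal J}:\mathbb R_+^{\mathcal J}\to\mathcal S_{\mathcal J}$ such that, for every $\rho^{\mathcal J}\in\mathbb R_+^{\mathcal J}$, if $\rho^v_e\to+\infty$ for all $e\in\mathcal E_v^+\setminus\mathcal J$ and $\rho^v_j\to\rho^{\mathcal J}_j$ for all $j\in\mathcal J$, then $G^v_e(\rho^v)\to0$ for all $e\in\mathcal E_v^+\setminus\mathcal J$ and $G^v_j(\rho^v)\to G^{\mathcal J}_j(\rho^{\mathcal J})$ for all $j\in\mathcal J$. Let $\lambda_0\ge0$ and consider the dynamical flow network $$\frac{\mathrm d}{\mathrm dt}\rho_e(t)=\lambda_v(t)\,G^v_e(\rho^v(t))-f_e(t),\qquad v\ne d,\ e\in\mathcal E_v^+,$$ where $f_e(t)=\mu_e(\rho_e(t))$, $\rho^v(t)=(\rho_e(t))_{e\in\mathcal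 E_v^+}$, $\lambda_o(t)=\lambda_0$, and $\lambda_v(t)=\sum_{e\in\mathcal E_v^-}f_e(t)$ for $v\ne o$. Then for every initial condition $\rho(0)\in\mathbb R_+^{\mathcal E}$ this system has a unique solution $\rho:[0,\infty)\to\mathbb R_+^{\mathcal E}$, and there exists a unique $f^*\in\mathrm{cl}(\mathcal F)$ such that, for every initial condition $\rho(0)\in\mathbb R_+^{\mathcal E}$, $$\lim_{t\to+\infty}f(t)=f^*.$$ Moreover, if $f^*_e=f_e^{\max}$ for some link $e\in\mathcal E_v^+$ outgoing from a node $v\ne d$, then $f^*_e=f_e^{\max}$ for every link $e\in\mathcal E_v^+$. -/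

import Mathlib

open Set Filter Topology

/-- A finite directed multigraph with node set `V` and links indexed by `E`: the link `e` points
from `tail e` to `head e`. Parallel links are allowed. -/
structure DirMultigraph (V E : Type*) where
  tail : E → V
  head : E → V

namespace DirMultigraph

variable {V E : Type*}

/-- `u` is joined to `w` by a link pointing from `u` to `w`. -/
def Link (T : DirMultigraph V E) (u w : V) : Prop :=
  ∃ e : E, T.tail e = u ∧ T.head e = w

/-- The links outgoing from the node `v`. -/
abbrev Out (T : DirMultigraph V E) (v : V) : Type _ := {e : E // T.tail e = v}

/-- The topology has no directed cycle, `o` is its unique node without incoming links, `d` is its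
unique node without outgoing links, and `d` can be reached from every node. -/
structure IsOriginDestination (T : DirMultigraph V E) (o d : V) : Prop where
  acyclic : ∀ v, ¬ Relation.TransGen T.Link v v
  origin_iff : ∀ v, (∀ e, T.head e ≠ v) ↔ v = o
  destination_iff : ∀ v, (∀ e, T.tail e ≠ v) ↔ v = d
  reach : ∀ v, Relation.ReflTransGen T.Link v d

end DirMultigraph

/-- A flow network: a directed multigraph and, for every link `e`, a flow function
`μ e : [0, ∞) → [0, ∞)`. Only the values of `μ e` on `[0, ∞)` matter. -/
structure FlowNetwork (V E : Type*) extends DirMultigraph V E where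
  μ : E → ℝ → ℝ
  μ_nonneg : ∀ e x, 0 ≤ x → 0 ≤ μ e x

namespace FlowNetwork

variable {V E : Type*}

/-- The flow capacity of the link `e`: the supremum of the flow function over `[0, ∞)`. -/
noncomputable def fmax (N : FlowNetwork V E) (e : E) : ℝ := sSup (N.μ e '' Ici 0)

/-- The standing regularity assumptions on the flow functions. -/
structure RegularFlow (N : FlowNetwork V E) : Prop where
  contDiffOn : ∀ e, ContDiffOn ℝ 1 (N.μ e) (Ici 0)
  strictMonoOn : ∀ e, StrictMonoOn (N.μ e) (Ici 0)
  deriv_bounded : ∀ e, ∃ C : ℝ, ∀ x, 0 ≤ x → |derivWithin (N.μ e) (Ici 0) x| ≤ C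
  zero : ∀ e, N.μ e 0 = 0
  bddAbove : ∀ e, BddAbove (N.μ e '' Ici 0)

/-- The set of admissible flow vectors `∏ₑ [0, fmax e)`. -/
def admissible (N : FlowNetwork V E) : Set (E → ℝ) :=
  Set.pi univ fun e => Ico 0 (N.fmax e)

/-- The flow vector determined by a density vector. -/
def flow (N : FlowNetwork V E) (ρ : E → ℝ) : E → ℝ := fun e => N.μ e (ρ e)

/-- The total inflow at the node `v` when the density vector is `ρ`: the constant `lam` at the
origin `o`, and the sum of the flows on the incoming links at every other node. -/
noncomputable def inflow [Fintype E] [DecidableEq V] (N : FlowNetwork V E) (o : V) (lam : ℝ)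
    (ρ : E → ℝ) (v : V) : ℝ :=
  if v = o then lam else ∑ e : E with N.head e = v, N.flow ρ e

end FlowNetwork

/-- A (candidate) distributed routing policy: for every node `v`, a function of the vector of
densities on the links outgoing from `v`, with values in the vectors indexed by the same links. -/
abbrev LocalRouting {V E : Type*} (T : DirMultigraph V E) : Type _ :=
  ∀ v : V, (T.Out v → ℝ) → (T.Out v → ℝ)

/-- `G` is a locally responsive distributed routing policy on the topology `T` with destination
`d`. Densities are nonnegative, so every condition concerns the closed orthant `Ici 0` only;
derivatives at its boundary are derivatives within it. -/
structure IsLocallyResponsive {V E : Type*} [Fintype E] [DecidableEq E] [DecidableEq V]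
    (T : DirMultigraph V E) (d : V) (G : LocalRouting T) : Prop where
  /-- `G v` maps nonnegative vectors to probability vectors. -/
  mapsTo : ∀ v, v ≠ d → MapsTo (G v) (Ici 0) (stdSimplex ℝ (T.Out v))
  /-- `G v` is continuously differentiable. -/
  contDiffOn : ∀ v, v ≠ d → ContDiffOn ℝ 1 (G v) (Ici 0)
  /-- Property (a): the partial derivative of `G v · j` with respect to the density on a link
  `e ≠ j` is nonnegative. -/
  partial_nonneg : ∀ v, v ≠ d → ∀ j e : T.Out v, j ≠ e → ∀ ρ : T.Out v → ℝ, 0 ≤ ρ →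
    0 ≤ derivWithin (fun x : ℝ => G v (Function.update ρ e x) j) (Ici 0) (ρ e)
  /-- Property (b): for every nonempty proper set `J` of links outgoing from `v` there is a
  continuously differentiable routing function `GJ` on `J` which is the limit of `G v` as the
  densities outside `J` tend to infinity and those in `J` converge. The limit is along an
  arbitrary filter `l` of nonnegative density vectors. -/
  limit : ∀ v, v ≠ d → ∀ J : Finset (T.Out v), J.Nonempty → J ≠ Finset.univ →
    ∃ GJ : (J → ℝ) → (J → ℝ),
      ContDiffOn ℝ 1 GJ (Ici 0) ∧ MapsTo GJ (Ici 0) (stdSimplex ℝ J) ∧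
      ∀ ρJ : J → ℝ, 0 ≤ ρJ → ∀ l : Filter (T.Out v → ℝ), (∀ᶠ ρ in l, 0 ≤ ρ) →
        (∀ e, e ∉ J → Tendsto (fun ρ => ρ e) l atTop) →
        (∀ j : J, Tendsto (fun ρ => ρ j) l (𝓝 (ρJ j))) →
        (∀ e, e ∉ J → Tendsto (fun ρ => G v ρ e) l (𝓝 0)) ∧
        (∀ j : J, Tendsto (fun ρ => G v ρ j) l (𝓝 (GJ ρJ j)))

namespace FlowNetwork

variable {V E : Type*} [Fintype E] [DecidableEq V]

/-- `ρ` is a solution on `[0, ∞)`, with nonnegative densities and initial condition `ρ₀`, of the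
dynamical flow network `dρₑ/dt = λ_v(t) G^v_e(ρ^v(t)) - μₑ(ρₑ(t))`, where `v = tail e`. -/
structure IsSolution (N : FlowNetwork V E) (o : V) (lam : ℝ)
    (G : LocalRouting N.toDirMultigraph) (ρ₀ : E → ℝ) (ρ : ℝ → E → ℝ) : Prop where
  init : ρ 0 = ρ₀
  nonneg : ∀ t, 0 ≤ t → 0 ≤ ρ t
  ode : ∀ t, 0 ≤ t → ∀ e, HasDerivWithinAt (fun s => ρ s e)
    (N.inflow o lam (ρ t) (N.tail e) * G (N.tail e) (fun j => ρ t j) ⟨e, rfl⟩ - N.flow (ρ t) e)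
    (Ici 0) t

/-- `f` lies in the closure of the set of admissible flow vectors, and from every initial density
vector the flow vector converges to `f` as time tends to infinity. -/
def IsLimitFlow (N : FlowNetwork V E) (o : V) (lam : ℝ)
    (G : LocalRouting N.toDirMultigraph) (f : E → ℝ) : Prop :=
  f ∈ closure N.admissible ∧
  ∀ ρ₀ : E → ℝ, 0 ≤ ρ₀ → ∀ ρ : ℝ → E → ℝ, N.IsSolution o lam G ρ₀ ρ →
    Tendsto (fun t => N.flow (ρ t)) atTop (𝓝 f)

end FlowNetwork

/-!
The dynamics are triangular along the acyclic network: the links leaving a node `v` form a local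
system driven only by the inflow at `v`, which is a sum of flows on links leaving predecessors of
`v`. Everything is therefore proved for one node with a time-dependent inflow and then propagated
by well-founded induction on the nodes.

At one node, the routing fractions sum to one and each is nondecreasing in the densities of the
*other* links. Consequently, the fraction routed to a set of links does not increase when the
densities on this set increase and the remaining ones decrease
(`IsCooperativeRouting.sum_le`). This makes the local system an `ℓ¹` contraction: the sum of the
positive parts of the difference of two solutions decreases at least at the rate at which the
corresponding flows differ, up to the difference of the inflows
(`IsNodeSolution.exists_deriv_posPart`). The inequality yields uniqueness of solutions and
attractivity of equilibria under convergent inflows.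

For an inflow below the total capacity, an equilibrium is the coordinatewise supremum of the
subsolutions `μ e (r e) ≤ a * g r e`, which are closed under suprema; the limit property of the
routing policy keeps them bounded (`exists_isNodeEquilibrium`). For an inflow at or above the total
capacity, the solution asymptotically dominates the equilibria for all smaller inflows, and these
come arbitrarily close to saturating every link (`IsNodeSolution.tendsto_flow_of_ge`). So the limit
flow saturates either none or all of the links leaving a node (`exists_node_limit`).

Existence of solutions follows from the Picard–Lindelöf theorem, applied to the velocity field
composed with the projection onto the nonnegative orthant: this field is bounded and locally
Lipschitz, and no component of it is negative where the corresponding density is nonpositive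
(`FlowNetwork.exists_isSolution`).
-/

/-! ### Right derivatives and differential inequalities -/

/-- The positive part of a differentiable function always has a right derivative; at a zero it is
the positive part of the derivative. -/
theorem hasDerivWithinAt_posPart {u : ℝ → ℝ} {u' t : ℝ} (hu : HasDerivWithinAt u u' (Ici t) t) :
    HasDerivWithinAt (fun s => max (u s) 0)
      (if 0 < u t ∨ (u t = 0 ∧ 0 < u') then u' else 0) (Ici t) t := by
  have hc : Tendsto u (𝓝[Ici t] t) (𝓝 (u t)) := hu.continuousWithinAt
  rcases lt_trichotomy (u t) 0 with h | h | h
  · rw [if_neg (by rintro (h' | h') <;> linarith [h'])]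
    refine (hasDerivWithinAt_const t (Ici t) (0 : ℝ)).congr_of_eventuallyEq ?_ (max_eq_right h.le)
    filter_upwards [hc.eventually (gt_mem_nhds h)] with s hs using max_eq_right hs.le
  · have hval : (if 0 < u t ∨ (u t = 0 ∧ 0 < u') then u' else 0) = max u' 0 := by
      by_cases hu' : 0 < u'
      · rw [if_pos (Or.inr ⟨h, hu'⟩), max_eq_left hu'.le]
      · rw [if_neg (by rintro (h' | h') <;> linarith [h']), max_eq_right (not_lt.1 hu')]
    rw [hval, ← hasDerivWithinAt_Ioi_iff_Ici, hasDerivWithinAt_iff_tendsto_slope' self_notMem_Ioi]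
    rw [← hasDerivWithinAt_Ioi_iff_Ici, hasDerivWithinAt_iff_tendsto_slope' self_notMem_Ioi] at hu
    refine (hu.max tendsto_const_nhds).congr' ?_
    filter_upwards [self_mem_nhdsWithin] with s hs
    have hs' : 0 < (s - t)⁻¹ := inv_pos.2 (sub_pos.2 hs)
    simp only [slope, h, vsub_eq_sub, sub_zero, smul_eq_mul, max_self]
    rw [mul_max_of_nonneg _ _ hs'.le, mul_zero]
  · rw [if_pos (Or.inl h)]
    refine hu.congr_of_eventuallyEq ?_ (max_eq_left h.le)
    filter_upwards [hc.eventually (lt_mem_nhds h)] with s hs using max_eq_left hs.le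

/-- A nonnegative function whose right derivative is eventually bounded above by a vanishing
error minus a dissipation term, the latter bounded away from zero as long as the function is,
tends to zero. -/
theorem tendsto_zero_of_dissipation {D D' ε δ : ℝ → ℝ} (hD0 : ∀ t, 0 ≤ t → 0 ≤ D t)
    (hD : ContinuousOn D (Ici 0)) (hD' : ∀ t, 0 ≤ t → HasDerivWithinAt D (D' t) (Ici t) t)
    (hε : Tendsto ε atTop (𝓝 0)) (hle : ∀ t, 0 ≤ t → D' t ≤ ε t - δ t)
    (hδ : ∀ r, 0 < r → ∃ c, 0 < c ∧ ∀ t, 0 ≤ t → r ≤ D t → c ≤ δ t) :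
    Tendsto D atTop (𝓝 0) := by
  refine (Metric.tendsto_atTop' (u := D)).2 fun r₁ hr₁ => ?_
  set r := r₁ / 2 with hr_def
  have hr : 0 < r := by positivity
  obtain ⟨c, hc, hcδ⟩ := hδ r hr
  obtain ⟨T, hT⟩ := eventually_atTop.1
    ((hε.eventually (gt_mem_nhds (half_pos hc))).and (eventually_ge_atTop 0))
  have hT0 : 0 ≤ T := (hT T le_rfl).2
  have hdec : ∀ t, T ≤ t → r ≤ D t → D' t < -(c / 2) := fun t ht hrt => by
    have h1 := hle t (hT0.trans ht)
    have h2 := hcδ t (hT0.trans ht) hrt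
    have h3 := (hT t ht).1
    linarith
  have hentry : ∃ S, T ≤ S ∧ D S ≤ r := by
    by_contra! hcon
    have hb : ∀ b, T ≤ b → D b ≤ D T - c / 2 * (b - T) := fun b hb => by
      have hB : ∀ x : ℝ, HasDerivAt (fun x => D T - c / 2 * (x - T)) (-(c / 2)) x := fun x => by
        simpa using (((hasDerivAt_id x).sub_const T).const_mul (c / 2)).const_sub (D T)
      exact image_le_of_deriv_right_lt_deriv_boundary (f := D) (f' := D') (a := T) (b := b)
        (hD.mono fun x hx => hT0.trans hx.1) (fun x hx => hD' x (hT0.trans hx.1))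
        (B := fun x => D T - c / 2 * (x - T)) (B' := fun _ => -(c / 2)) (by simp) hB
        (fun x hx _ => hdec x hx.1 (hcon x hx.1).le) ⟨hb, le_rfl⟩
    have hDT : 0 ≤ D T := hD0 T hT0
    have h1 := hb (T + 2 * D T / c) (by have : 0 ≤ 2 * D T / c := by positivity
                                        linarith)
    have h2 := hcon (T + 2 * D T / c) (by have : 0 ≤ 2 * D T / c := by positivity
                                          linarith)
    have h3 : c / 2 * (T + 2 * D T / c - T) = D T := by field_simp; ring
    rw [h3] at h1
    linarith
  obtain ⟨S, hTS, hS⟩ := hentry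
  refine ⟨S, fun t ht => ?_⟩
  have h0S := hT0.trans hTS
  have h := image_le_of_deriv_right_lt_deriv_boundary (f := D) (f' := D') (a := S) (b := t)
    (hD.mono fun x hx => h0S.trans hx.1) (fun x hx => hD' x (h0S.trans hx.1))
    (B := fun _ => r) (B' := fun _ => 0) hS (fun x => hasDerivAt_const x r)
    (fun x hx hx' => (hdec x (hTS.trans hx.1) hx'.ge).trans (by linarith)) ⟨ht.le, le_rfl⟩
  rw [Real.dist_eq, sub_zero, abs_of_nonneg (hD0 t (h0S.trans ht.le))]
  linarith

/-! ### Routing at a single node -/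

/-- A family of flow functions on `[0, ∞)`: continuous, strictly increasing, vanishing at `0` and
bounded. -/
structure IsFlowFamily {ι : Type*} (μ : ι → ℝ → ℝ) : Prop where
  continuousOn : ∀ e, ContinuousOn (μ e) (Ici 0)
  strictMonoOn : ∀ e, StrictMonoOn (μ e) (Ici 0)
  zero : ∀ e, μ e 0 = 0
  bddAbove : ∀ e, BddAbove (μ e '' Ici 0)

/-- The properties of the routing function at one node that matter for the dynamics: it maps
nonnegative vectors to probability vectors, it is continuous, its `j`-th component is nondecreasing
in the coordinates other than the `j`-th, and, along any sequence of densities that diverges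
exactly outside a nonempty proper set `J` of links and converges on `J`, the fractions routed to the
links outside `J` vanish. -/
structure IsCooperativeRouting {ι : Type*} [Fintype ι] (g : (ι → ℝ) → (ι → ℝ)) : Prop where
  mapsTo : MapsTo g (Ici 0) (stdSimplex ℝ ι)
  continuousOn : ContinuousOn g (Ici 0)
  mono : ∀ x y : ι → ℝ, 0 ≤ x → x ≤ y → ∀ j, x j = y j → g x j ≤ g y j
  escape : ∀ J : Finset ι, J.Nonempty → J ≠ Finset.univ → ∀ (s : ι → ℝ) (u : ℕ → ι → ℝ),
    (∀ n, 0 ≤ u n) → (∀ e, e ∉ J → Tendsto (fun n => u n e) atTop atTop) →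
    (∀ e, e ∈ J → Tendsto (fun n => u n e) atTop (𝓝 (s e))) →
    ∀ e, e ∉ J → Tendsto (fun n => g (u n) e) atTop (𝓝 0)

/-- `x` is a nonnegative solution on `[0, ∞)` of the dynamics of the links leaving one node, when
the inflow at this node is the given function `l` of time. -/
structure IsNodeSolution {ι : Type*} (μ : ι → ℝ → ℝ) (g : (ι → ℝ) → (ι → ℝ)) (l : ℝ → ℝ)
    (x : ℝ → ι → ℝ) : Prop where
  nonneg : ∀ t, 0 ≤ t → 0 ≤ x t
  ode : ∀ t, 0 ≤ t → ∀ e, HasDerivWithinAt (fun s => x s e) (l t * g (x t) e - μ e (x t e))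
    (Ici 0) t

section Node

variable {ι : Type*} {μ : ι → ℝ → ℝ} {g : (ι → ℝ) → (ι → ℝ)}

theorem IsFlowFamily.nonneg (hμ : IsFlowFamily μ) (e : ι) {x : ℝ} (hx : 0 ≤ x) : 0 ≤ μ e x := by
  rw [← hμ.zero e]
  exact (hμ.strictMonoOn e).monotoneOn (mem_Ici.2 le_rfl) hx hx

theorem IsFlowFamily.le_sSup (hμ : IsFlowFamily μ) (e : ι) {x : ℝ} (hx : 0 ≤ x) :
    μ e x ≤ sSup (μ e '' Ici 0) :=
  le_csSup (hμ.bddAbove e) (mem_image_of_mem _ hx)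

theorem IsFlowFamily.lt_sSup (hμ : IsFlowFamily μ) (e : ι) {x : ℝ} (hx : 0 ≤ x) :
    μ e x < sSup (μ e '' Ici 0) :=
  (hμ.strictMonoOn e hx (mem_Ici.2 (by linarith : (0 : ℝ) ≤ x + 1)) (lt_add_one x)).trans_le
    (hμ.le_sSup e (by linarith))

theorem IsFlowFamily.tendsto_atTop (hμ : IsFlowFamily μ) (e : ι) :
    Tendsto (μ e) atTop (𝓝 (sSup (μ e '' Ici 0))) := by
  refine tendsto_order.2 ⟨fun a ha => ?_, fun a ha => ?_⟩
  · obtain ⟨_, ⟨x, hx, rfl⟩, hax⟩ := exists_lt_of_lt_csSup (nonempty_Ici.image _) ha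
    filter_upwards [eventually_ge_atTop x] with y hy
    exact hax.trans_le ((hμ.strictMonoOn e).monotoneOn hx (le_trans hx hy) hy)
  · filter_upwards [eventually_ge_atTop 0] with y hy using (hμ.le_sSup e hy).trans_lt ha

/-- Quantitative strict monotonicity: densities at distance at least `r` from a given density have
flows at a distance bounded away from zero. -/
theorem IsFlowFamily.exists_gap (hμ : IsFlowFamily μ) (e : ι) {y r : ℝ} (hy : 0 ≤ y)
    (hr : 0 < r) : ∃ c, 0 < c ∧ ∀ x, 0 ≤ x →
      (r ≤ x - y → c ≤ μ e x - μ e y) ∧ (r ≤ y - x → c ≤ μ e y - μ e x) := by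
  have hm := (hμ.strictMonoOn e)
  have h1 : 0 < μ e (y + r) - μ e y :=
    sub_pos.2 (hm hy (mem_Ici.2 (by linarith)) (by linarith))
  by_cases hry : r ≤ y
  · have h2 : 0 < μ e y - μ e (y - r) :=
      sub_pos.2 (hm (mem_Ici.2 (by linarith)) hy (by linarith))
    refine ⟨min (μ e (y + r) - μ e y) (μ e y - μ e (y - r)), lt_min h1 h2, fun x hx =>
      ⟨fun h => (min_le_left _ _).trans ?_, fun h => (min_le_right _ _).trans ?_⟩⟩
    · have := hm.monotoneOn (mem_Ici.2 (by linarith : 0 ≤ y + r)) hx (by linarith)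
      linarith
    · have := hm.monotoneOn hx (mem_Ici.2 (by linarith : 0 ≤ y - r)) (by linarith)
      linarith
  · refine ⟨μ e (y + r) - μ e y, h1, fun x hx => ⟨fun h => ?_, fun h => ?_⟩⟩
    · have := hm.monotoneOn (mem_Ici.2 (by linarith : 0 ≤ y + r)) hx (by linarith)
      linarith
    · linarith

/-- `y` is an equilibrium of the dynamics at one node with constant inflow `a`. -/
structure IsNodeEquilibrium (μ : ι → ℝ → ℝ) (g : (ι → ℝ) → (ι → ℝ)) (a : ℝ) (y : ι → ℝ) :
    Prop where
  nonneg : 0 ≤ y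
  balance : ∀ e, μ e (y e) = a * g y e

theorem IsNodeEquilibrium.isNodeSolution {a : ℝ} {y : ι → ℝ} (hy : IsNodeEquilibrium μ g a y) :
    IsNodeSolution μ g (fun _ => a) (fun _ => y) where
  nonneg := fun _ _ => hy.nonneg
  ode := fun t _ e => by
    rw [← hy.balance e, sub_self]
    exact hasDerivWithinAt_const _ _ _

variable [Fintype ι]

/-- The fraction routed to a set `A` of links does not increase when the densities on `A` increase
and the other ones decrease. -/
theorem IsCooperativeRouting.sum_le (hg : IsCooperativeRouting g) {x y : ι → ℝ} (hx : 0 ≤ x)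
    (hy : 0 ≤ y) (A : Finset ι) (hA : ∀ e ∈ A, y e ≤ x e) (hA' : ∀ e, e ∉ A → x e ≤ y e) :
    ∑ e ∈ A, g x e ≤ ∑ e ∈ A, g y e := by
  classical
  have hm : (0 : ι → ℝ) ≤ x ⊔ y := hx.trans le_sup_left
  have h1 : ∑ e ∈ A, g x e ≤ ∑ e ∈ A, g (x ⊔ y) e := Finset.sum_le_sum fun e he =>
    hg.mono x _ hx le_sup_left e (sup_eq_left.2 (hA e he)).symm
  have h2 : ∑ e ∈ Aᶜ, g y e ≤ ∑ e ∈ Aᶜ, g (x ⊔ y) e := Finset.sum_le_sum fun e he =>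
    hg.mono y _ hy le_sup_right e (sup_eq_right.2 (hA' e (Finset.mem_compl.1 he))).symm
  have h3 := Finset.sum_add_sum_compl A (g (x ⊔ y))
  have h4 := Finset.sum_add_sum_compl A (g y)
  rw [(hg.mapsTo hm).2] at h3
  rw [(hg.mapsTo hy).2] at h4
  linarith

/-- The `ℓ¹` dissipation inequality: the positive part of the difference of two solutions at the
same node decreases at least at the rate at which their flows differ, up to the difference of the
inflows. -/
theorem IsNodeSolution.exists_deriv_posPart (hμ : IsFlowFamily μ) (hg : IsCooperativeRouting g)
    {l m : ℝ → ℝ} {x y : ℝ → ι → ℝ} (hx : IsNodeSolution μ g l x) (hy : IsNodeSolution μ g m y)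
    {t : ℝ} (ht : 0 ≤ t) (hm : 0 ≤ m t) :
    ∃ D', HasDerivWithinAt (fun s => ∑ e, max (x s e - y s e) 0) D' (Ici t) t ∧
      D' ≤ max (l t - m t) 0 - ∑ e, max (μ e (x t e) - μ e (y t e)) 0 := by
  classical
  set u' : ι → ℝ := fun e => (l t * g (x t) e - μ e (x t e)) - (m t * g (y t) e - μ e (y t e))
    with hu'
  have hu : ∀ e, HasDerivWithinAt (fun s => x s e - y s e) (u' e) (Ici t) t := fun e =>
    ((hx.ode t ht e).sub (hy.ode t ht e)).mono (Ici_subset_Ici.2 ht)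
  refine ⟨_, HasDerivWithinAt.fun_sum fun e _ => hasDerivWithinAt_posPart (hu e), ?_⟩
  rw [← Finset.sum_filter]
  set A := Finset.univ.filter fun e => 0 < x t e - y t e ∨ x t e - y t e = 0 ∧ 0 < u' e with hA
  have hA1 : ∀ e ∈ A, y t e ≤ x t e := fun e he => by
    rcases (Finset.mem_filter.1 he).2 with h | h <;> linarith [h]
  have hA2 : ∀ e, e ∉ A → x t e ≤ y t e := fun e he => by
    by_contra h
    exact he (Finset.mem_filter.2 ⟨Finset.mem_univ e, Or.inl (sub_pos.2 (not_le.1 h))⟩)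
  have h1 := hg.sum_le (hx.nonneg t ht) (hy.nonneg t ht) A hA1 hA2
  have hsx := hg.mapsTo (hx.nonneg t ht)
  have h2 : ∑ e ∈ A, g (x t) e ≤ 1 := by
    rw [← hsx.2]
    exact Finset.sum_le_sum_of_subset_of_nonneg (Finset.subset_univ _) fun e _ _ => hsx.1 e
  have h2' : 0 ≤ ∑ e ∈ A, g (x t) e := Finset.sum_nonneg fun e _ => hsx.1 e
  have h3 : ∑ e, max (μ e (x t e) - μ e (y t e)) 0 = ∑ e ∈ A, (μ e (x t e) - μ e (y t e)) := by
    rw [← Finset.sum_add_sum_compl A, Finset.sum_eq_zero (s := Aᶜ), add_zero]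
    · refine Finset.sum_congr rfl fun e he => max_eq_left (sub_nonneg.2 ?_)
      exact (hμ.strictMonoOn e).monotoneOn (hy.nonneg t ht e) (hx.nonneg t ht e) (hA1 e he)
    · intro e he
      refine max_eq_right (sub_nonpos.2 ?_)
      exact (hμ.strictMonoOn e).monotoneOn (hx.nonneg t ht e) (hy.nonneg t ht e)
        (hA2 e (Finset.mem_compl.1 he))
  have h4 : ∑ e ∈ A, u' e = m t * (∑ e ∈ A, g (x t) e - ∑ e ∈ A, g (y t) e)
      + (l t - m t) * ∑ e ∈ A, g (x t) e - ∑ e ∈ A, (μ e (x t e) - μ e (y t e)) := by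
    simp only [hu', Finset.sum_sub_distrib, Finset.mul_sum, mul_sub, sub_mul]
    ring
  rw [h3, h4]
  have h5 : m t * (∑ e ∈ A, g (x t) e - ∑ e ∈ A, g (y t) e) ≤ 0 :=
    mul_nonpos_of_nonneg_of_nonpos hm (by linarith)
  have h6 : (l t - m t) * ∑ e ∈ A, g (x t) e ≤ max (l t - m t) 0 :=
    (mul_le_mul_of_nonneg_right (le_max_left _ 0) h2').trans
      (mul_le_of_le_one_right (le_max_right _ _) h2)
  linarith

theorem IsNodeSolution.continuousOn_posPart {l m : ℝ → ℝ} {x y : ℝ → ι → ℝ}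
    (hx : IsNodeSolution μ g l x) (hy : IsNodeSolution μ g m y) :
    ContinuousOn (fun s => ∑ e, max (x s e - y s e) 0) (Ici 0) := by
  refine continuousOn_finsetSum _ fun e _ => ContinuousOn.sup (ContinuousOn.sub ?_ ?_)
    continuousOn_const
  · exact fun t ht => (hx.ode t ht e).continuousWithinAt
  · exact fun t ht => (hy.ode t ht e).continuousWithinAt

/-- Comparison principle: solutions with larger inflow and larger initial densities are larger. -/
theorem IsNodeSolution.le (hμ : IsFlowFamily μ) (hg : IsCooperativeRouting g)
    {l m : ℝ → ℝ} {x y : ℝ → ι → ℝ} (hx : IsNodeSolution μ g l x) (hy : IsNodeSolution μ g m y)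
    (hm : ∀ t, 0 ≤ t → 0 ≤ m t) (hlm : ∀ t, 0 ≤ t → l t ≤ m t) (h0 : x 0 ≤ y 0)
    {t : ℝ} (ht : 0 ≤ t) : x t ≤ y t := by
  choose! D' hD' hD'le using fun s (hs : 0 ≤ s) =>
    hx.exists_deriv_posPart hμ hg hy hs (hm s hs)
  have hle := image_le_of_deriv_right_le_deriv_boundary (a := 0) (b := t)
    ((hx.continuousOn_posPart hy).mono Icc_subset_Ici_self) (fun s hs => hD' s hs.1)
    (B := fun _ => 0) (B' := fun _ => 0)
    (Finset.sum_nonpos fun e _ => max_le (sub_nonpos.2 (h0 e)) le_rfl) continuousOn_const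
    (fun s _ => hasDerivWithinAt_const _ _ _) (fun s hs => (hD'le s hs.1).trans ?_)
    ⟨ht, le_rfl⟩
  · intro e
    have h1 := Finset.single_le_sum (f := fun e => max (x t e - y t e) 0)
      (fun e _ => le_max_right _ _) (Finset.mem_univ e)
    have h2 := le_max_left (x t e - y t e) 0
    linarith
  · rw [max_eq_right (sub_nonpos.2 (hlm s hs.1)), zero_sub, neg_nonpos]
    exact Finset.sum_nonneg fun e _ => le_max_right _ _

theorem exists_le_of_le_sum_posPart {r : ℝ} (hr : 0 < r) {a : ι → ℝ}
    (h : r ≤ ∑ e, max (a e) 0) : ∃ e, r / Fintype.card ι ≤ a e := by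
  by_contra! hcon
  rcases isEmpty_or_nonempty ι with h' | h'
  · simp at h; linarith
  have hc : 0 < (Fintype.card ι : ℝ) := by exact_mod_cast Fintype.card_pos
  have : ∑ e, max (a e) 0 < ∑ _e : ι, r / Fintype.card ι :=
    Finset.sum_lt_sum_of_nonempty Finset.univ_nonempty fun e _ => max_lt (hcon e) (by positivity)
  rw [Finset.sum_const, Finset.card_univ, nsmul_eq_mul, mul_div_cancel₀ _ hc.ne'] at this
  linarith

/-- The dissipation in the `ℓ¹` inequality is bounded away from zero as long as the distance to
the reference densities is. -/
theorem IsFlowFamily.exists_uniform_gap (hμ : IsFlowFamily μ) {y : ι → ℝ} (hy : 0 ≤ y) {r : ℝ}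
    (hr : 0 < r) : ∃ c, 0 < c ∧ ∀ x : ι → ℝ, 0 ≤ x →
      (r ≤ ∑ e, max (x e - y e) 0 → c ≤ ∑ e, max (μ e (x e) - μ e (y e)) 0) ∧
      (r ≤ ∑ e, max (y e - x e) 0 → c ≤ ∑ e, max (μ e (y e) - μ e (x e)) 0) := by
  rcases isEmpty_or_nonempty ι with h' | h'
  · exact ⟨1, one_pos, fun x _ => by simp [hr]⟩
  have hc : 0 < (Fintype.card ι : ℝ) := by exact_mod_cast Fintype.card_pos
  choose c hc0 hc using fun e => hμ.exists_gap e (hy e) (div_pos hr hc)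
  refine ⟨Finset.univ.inf' Finset.univ_nonempty c,
    (Finset.lt_inf'_iff _).2 fun e _ => hc0 e, fun x hx => ⟨fun h => ?_, fun h => ?_⟩⟩ <;>
  obtain ⟨e, he⟩ := exists_le_of_le_sum_posPart hr h
  · exact ((Finset.inf'_le _ (Finset.mem_univ e)).trans ((hc e _ (hx e)).1 he)).trans
      ((le_max_left _ 0).trans (Finset.single_le_sum
        (f := fun e => max (μ e (x e) - μ e (y e)) 0) (fun e _ => le_max_right _ _)
        (Finset.mem_univ e)))
  · exact ((Finset.inf'_le _ (Finset.mem_univ e)).trans ((hc e _ (hx e)).2 he)).trans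
      ((le_max_left _ 0).trans (Finset.single_le_sum
        (f := fun e => max (μ e (y e) - μ e (x e)) 0) (fun e _ => le_max_right _ _)
        (Finset.mem_univ e)))

/-- A solution asymptotically does not exceed an equilibrium whose inflow asymptotically is not
exceeded. -/
theorem IsNodeSolution.tendsto_excess (hμ : IsFlowFamily μ) (hg : IsCooperativeRouting g)
    {l : ℝ → ℝ} {a : ℝ} {x : ℝ → ι → ℝ} {y : ι → ℝ} (hx : IsNodeSolution μ g l x)
    (hy : IsNodeEquilibrium μ g a y) (ha : 0 ≤ a)
    (hla : Tendsto (fun t => max (l t - a) 0) atTop (𝓝 0)) (e : ι) :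
    Tendsto (fun t => max (x t e - y e) 0) atTop (𝓝 0) := by
  choose! D' hD' hD'le using fun s (hs : 0 ≤ s) =>
    hx.exists_deriv_posPart hμ hg hy.isNodeSolution hs ha
  have h := tendsto_zero_of_dissipation
    (fun t _ => Finset.sum_nonneg fun e _ => le_max_right _ _)
    (hx.continuousOn_posPart hy.isNodeSolution) hD' hla hD'le fun r hr => ?_
  · exact squeeze_zero (fun t => le_max_right _ _) (fun t => Finset.single_le_sum
      (f := fun e => max (x t e - y e) 0) (fun e _ => le_max_right _ _) (Finset.mem_univ e)) h
  · obtain ⟨c, hc, h⟩ := hμ.exists_uniform_gap hy.nonneg hr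
    exact ⟨c, hc, fun t ht => (h _ (hx.nonneg t ht)).1⟩

/-- A solution asymptotically does not lie below an equilibrium whose inflow asymptotically is
reached. -/
theorem IsNodeSolution.tendsto_deficit (hμ : IsFlowFamily μ) (hg : IsCooperativeRouting g)
    {l : ℝ → ℝ} {a : ℝ} {x : ℝ → ι → ℝ} {y : ι → ℝ} (hx : IsNodeSolution μ g l x)
    (hy : IsNodeEquilibrium μ g a y) (hl : ∀ t, 0 ≤ t → 0 ≤ l t)
    (hla : Tendsto (fun t => max (a - l t) 0) atTop (𝓝 0)) (e : ι) :
    Tendsto (fun t => max (y e - x t e) 0) atTop (𝓝 0) := by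
  choose! D' hD' hD'le using fun s (hs : 0 ≤ s) =>
    hy.isNodeSolution.exists_deriv_posPart hμ hg hx hs (hl s hs)
  have h := tendsto_zero_of_dissipation
    (fun t _ => Finset.sum_nonneg fun e _ => le_max_right _ _)
    (hy.isNodeSolution.continuousOn_posPart hx) hD' hla hD'le fun r hr => ?_
  · exact squeeze_zero (fun t => le_max_right _ _) (fun t => Finset.single_le_sum
      (f := fun e => max (y e - x t e) 0) (fun e _ => le_max_right _ _) (Finset.mem_univ e)) h
  · obtain ⟨c, hc, h⟩ := hμ.exists_uniform_gap hy.nonneg hr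
    exact ⟨c, hc, fun t ht => (h _ (hx.nonneg t ht)).2⟩

end Node

/-! ### Equilibria of a node -/

section NodeEquilibrium

variable {ι : Type*} [Fintype ι] {μ : ι → ℝ → ℝ} {g : (ι → ℝ) → (ι → ℝ)} {a : ℝ}

/-- The density vectors at which, for the constant inflow `a`, no component of the dynamics at the
node is decreasing. -/
def nodeSubsolutions (μ : ι → ℝ → ℝ) (g : (ι → ℝ) → (ι → ℝ)) (a : ℝ) : Set (ι → ℝ) :=
  {r | 0 ≤ r ∧ ∀ e, μ e (r e) ≤ a * g r e}

theorem IsCooperativeRouting.nonempty (hg : IsCooperativeRouting g) : Nonempty ι := by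
  by_contra h
  rw [not_nonempty_iff] at h
  simpa using (hg.mapsTo (mem_Ici.2 (le_refl (0 : ι → ℝ)))).2

theorem zero_mem_nodeSubsolutions (hμ : IsFlowFamily μ) (hg : IsCooperativeRouting g)
    (ha : 0 ≤ a) : 0 ∈ nodeSubsolutions μ g a :=
  ⟨le_rfl, fun e => by
    rw [Pi.zero_apply, hμ.zero e]
    exact mul_nonneg ha ((hg.mapsTo (mem_Ici.2 (le_refl (0 : ι → ℝ)))).1 e)⟩

theorem supClosed_nodeSubsolutions (hg : IsCooperativeRouting g) (ha : 0 ≤ a) :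
    SupClosed (nodeSubsolutions μ g a) := by
  intro r hr s hs
  refine ⟨hr.1.trans le_sup_left, fun e => ?_⟩
  rcases le_total (s e) (r e) with h | h
  · have h1 : r e = (r ⊔ s) e := (sup_eq_left.2 h).symm
    rw [← h1]
    exact (hr.2 e).trans (mul_le_mul_of_nonneg_left (hg.mono r _ hr.1 le_sup_left e h1) ha)
  · have h1 : s e = (r ⊔ s) e := (sup_eq_right.2 h).symm
    rw [← h1]
    exact (hs.2 e).trans (mul_le_mul_of_nonneg_left (hg.mono s _ hs.1 le_sup_right e h1) ha)

/-- Since subsolutions are closed under suprema, one sequence of subsolutions approaches the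
supremum, finite or infinite, of every coordinate simultaneously. -/
theorem exists_seq_nodeSubsolutions (hμ : IsFlowFamily μ) (hg : IsCooperativeRouting g)
    (ha : 0 ≤ a) : ∃ w : ℕ → ι → ℝ, (∀ n, w n ∈ nodeSubsolutions μ g a) ∧ ∀ e,
      (BddAbove ((fun r => r e) '' nodeSubsolutions μ g a) →
        Tendsto (fun n => w n e) atTop (𝓝 (sSup ((fun r => r e) '' nodeSubsolutions μ g a)))) ∧
      (¬ BddAbove ((fun r => r e) '' nodeSubsolutions μ g a) →
        Tendsto (fun n => w n e) atTop atTop) := by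
  have := hg.nonempty
  set S := nodeSubsolutions μ g a with hS
  have hne : S.Nonempty := ⟨0, zero_mem_nodeSubsolutions hμ hg ha⟩
  have key : ∀ e, ∃ u : ℕ → ι → ℝ, (∀ n, u n ∈ S) ∧
      (BddAbove ((fun r => r e) '' S) →
        Tendsto (fun n => u n e) atTop (𝓝 (sSup ((fun r => r e) '' S)))) ∧
      (¬ BddAbove ((fun r => r e) '' S) → Tendsto (fun n => u n e) atTop atTop) := by
    intro e
    by_cases hb : BddAbove ((fun r => r e) '' S)
    · obtain ⟨v, -, hv, hvS⟩ := exists_seq_tendsto_sSup (hne.image fun r => r e) hb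
      choose u huS hu using hvS
      refine ⟨u, huS, fun _ => ?_, fun h => absurd hb h⟩
      simpa only [hu] using hv
    · have : ∀ n : ℕ, ∃ r ∈ S, (n : ℝ) < r e := fun n => by
        obtain ⟨_, ⟨r, hr, rfl⟩, h⟩ := not_bddAbove_iff.1 hb n
        exact ⟨r, hr, h⟩
      choose u huS hu using this
      exact ⟨u, huS, fun h => absurd h hb, fun _ =>
        tendsto_atTop_mono (fun n => (hu n).le) tendsto_natCast_atTop_atTop⟩
  choose u huS hu using key
  set w : ℕ → ι → ℝ := fun n => Finset.univ.sup' Finset.univ_nonempty fun e => u e n with hw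
  have hwS : ∀ n, w n ∈ S := fun n =>
    (supClosed_nodeSubsolutions hg ha).finsetSup'_mem _ fun e _ => huS e n
  have hle : ∀ n e, u e n e ≤ w n e := fun n e =>
    (Finset.le_sup' (fun e => u e n) (Finset.mem_univ e) : u e n ≤ w n) e
  exact ⟨w, hwS, fun e => ⟨fun hb => tendsto_of_tendsto_of_tendsto_of_le_of_le ((hu e).1 hb)
    tendsto_const_nhds (fun n => hle n e) (fun n => le_csSup hb ⟨w n, hwS n, rfl⟩),
    fun hb => tendsto_atTop_mono (fun n => hle n e) ((hu e).2 hb)⟩⟩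

/-- When the inflow is below the total capacity, the subsolutions are bounded: if only some of
the densities could grow, the routing would divert the inflow from the corresponding links, and if
all could, the total flow would exceed the inflow. -/
theorem bddAbove_nodeSubsolutions (hμ : IsFlowFamily μ) (hg : IsCooperativeRouting g)
    (ha : 0 ≤ a) (hlt : a < ∑ e, sSup (μ e '' Ici 0)) (e : ι) :
    BddAbove ((fun r => r e) '' nodeSubsolutions μ g a) := by
  classical
  by_contra he
  obtain ⟨w, hwS, hw⟩ := exists_seq_nodeSubsolutions hμ hg ha
  set J := Finset.univ.filter fun e => BddAbove ((fun r => r e) '' nodeSubsolutions μ g a)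
    with hJ
  have hout : ∀ e, e ∉ J → Tendsto (fun n => w n e) atTop atTop := fun e he =>
    (hw e).2 fun h => he (Finset.mem_filter.2 ⟨Finset.mem_univ e, h⟩)
  have heJ : e ∉ J := fun h => he (Finset.mem_filter.1 h).2
  have hflow : ∀ e, e ∉ J → Tendsto (fun n => μ e (w n e)) atTop (𝓝 (sSup (μ e '' Ici 0))) :=
    fun e he => (hμ.tendsto_atTop e).comp (hout e he)
  by_cases hJne : J.Nonempty
  · have h0 := hg.escape J hJne (fun h => heJ (h ▸ Finset.mem_univ e)) _ w (fun n => (hwS n).1)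
      hout (fun e he => (hw e).1 (Finset.mem_filter.1 he).2) e heJ
    have h1 := le_of_tendsto_of_tendsto' (hflow e heJ) (h0.const_mul a) fun n => (hwS n).2 e
    have h2 := hμ.lt_sSup e le_rfl
    rw [hμ.zero e] at h2
    linarith
  · rw [Finset.not_nonempty_iff_eq_empty] at hJne
    have h1 : Tendsto (fun n => ∑ e, μ e (w n e)) atTop (𝓝 (∑ e, sSup (μ e '' Ici 0))) :=
      tendsto_finsetSum _ fun e _ => hflow e (by simp [hJne])
    refine hlt.not_ge (le_of_tendsto' h1 fun n => ?_)
    calc ∑ e, μ e (w n e) ≤ ∑ e, a * g (w n) e := Finset.sum_le_sum fun e _ => (hwS n).2 e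
      _ = a := by rw [← Finset.mul_sum, (hg.mapsTo (hwS n).1).2, mul_one]

/-- When the inflow is below the total capacity, the largest subsolution is an equilibrium. -/
theorem exists_isNodeEquilibrium (hμ : IsFlowFamily μ) (hg : IsCooperativeRouting g)
    (ha : 0 ≤ a) (hlt : a < ∑ e, sSup (μ e '' Ici 0)) : ∃ y, IsNodeEquilibrium μ g a y := by
  classical
  obtain ⟨w, hwS, hw⟩ := exists_seq_nodeSubsolutions hμ hg ha
  have hb := bddAbove_nodeSubsolutions hμ hg ha hlt
  set S := nodeSubsolutions μ g a with hS
  set y : ι → ℝ := fun e => sSup ((fun r => r e) '' S) with hy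
  have hle : ∀ r ∈ S, ∀ e, r e ≤ y e := fun r hr e => le_csSup (hb e) ⟨r, hr, rfl⟩
  have hy0 : 0 ≤ y := hle 0 (zero_mem_nodeSubsolutions hμ hg ha)
  have hwy : ∀ e, Tendsto (fun n => w n e) atTop (𝓝 (y e)) := fun e => (hw e).1 (hb e)
  have hgw : Tendsto (fun n => g (w n)) atTop (𝓝 (g y)) :=
    (hg.continuousOn y hy0).tendsto.comp (tendsto_nhdsWithin_iff.2
      ⟨tendsto_pi_nhds.2 hwy, Eventually.of_forall fun n => (hwS n).1⟩)
  have hμw : ∀ e, Tendsto (fun n => μ e (w n e)) atTop (𝓝 (μ e (y e))) := fun e =>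
    (hμ.continuousOn e (y e) (hy0 e)).tendsto.comp (tendsto_nhdsWithin_iff.2
      ⟨hwy e, Eventually.of_forall fun n => (hwS n).1 e⟩)
  have hyS : ∀ e, μ e (y e) ≤ a * g y e := fun e =>
    le_of_tendsto_of_tendsto' (hμw e) ((tendsto_pi_nhds.1 hgw e).const_mul a) fun n => (hwS n).2 e
  refine ⟨y, hy0, fun e => (hyS e).antisymm ?_⟩
  by_contra! hcon
  -- A component with strict inequality could be increased a little within the subsolutions.
  have hcont : ContinuousWithinAt (fun s => a * g (Function.update y e s) e - μ e s)
      (Ici (y e)) (y e) := by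
    have hu : ContinuousWithinAt (fun s => Function.update y e s) (Ici (y e)) (y e) :=
      (continuous_const.update e continuous_id).continuousWithinAt
    have hmaps : MapsTo (fun s => Function.update y e s) (Ici (y e)) (Ici 0) := fun s hs => by
      refine hy0.trans (le_update_iff.2 ⟨hs, fun _ _ => le_rfl⟩)
    have h1 : ContinuousWithinAt g (Ici 0) (Function.update y e (y e)) := by
      rw [Function.update_eq_self]
      exact hg.continuousOn y hy0
    refine (continuousWithinAt_const.mul (continuousWithinAt_pi.1
      (ContinuousWithinAt.comp (t := Ici 0) h1 hu hmaps) e)).sub ?_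
    exact (hμ.continuousOn e (y e) (hy0 e)).mono (Ici_subset_Ici.2 (hy0 e))
  have hpos : 0 < a * g (Function.update y e (y e)) e - μ e (y e) := by
    rw [Function.update_eq_self]
    linarith
  have hev := (hcont.eventually (lt_mem_nhds hpos)).filter_mono
    (nhdsWithin_mono _ Ioi_subset_Ici_self)
  obtain ⟨s, hs, hys⟩ := (hev.and self_mem_nhdsWithin).exists
  have hys : y e < s := hys
  have hyz : y ≤ Function.update y e s := le_update_iff.2 ⟨hys.le, fun _ _ => le_rfl⟩
  have hzS : Function.update y e s ∈ S := by
    refine ⟨hy0.trans hyz, fun j => ?_⟩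
    by_cases hj : j = e
    · subst hj
      rw [Function.update_self]
      linarith
    · have hj' : y j = Function.update y e s j := (Function.update_of_ne hj _ _).symm
      rw [← hj']
      exact (hyS j).trans (mul_le_mul_of_nonneg_left (hg.mono y _ hy0 hyz j hj') ha)
  have := hle _ hzS e
  rw [Function.update_self] at this
  linarith

theorem IsNodeEquilibrium.sum_flow (hg : IsCooperativeRouting g) {y : ι → ℝ}
    (hy : IsNodeEquilibrium μ g a y) : ∑ e, μ e (y e) = a := by
  simp only [hy.balance, ← Finset.mul_sum, (hg.mapsTo hy.nonneg).2, mul_one]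

/-! ### Attractivity at a single node -/

/-- A density that asymptotically does not lie below `y` has a flow that asymptotically does not
lie below the flow at `y`. -/
theorem IsFlowFamily.eventually_lt_of_tendsto_deficit {κ : Type*} {ν : κ → ℝ → ℝ}
    (hν : IsFlowFamily ν) (e : κ) {x : ℝ → ℝ} {y b : ℝ} (hx : ∀ t, 0 ≤ t → 0 ≤ x t) (hy : 0 ≤ y)
    (h : Tendsto (fun t => max (y - x t) 0) atTop (𝓝 0)) (hb : b < ν e y) :
    ∀ᶠ t in atTop, b < ν e (x t) := by
  have h1 : Tendsto (fun t => min (x t) y) atTop (𝓝 y) := by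
    have h2 : Tendsto (fun t => y - max (y - x t) 0) atTop (𝓝 (y - 0)) := h.const_sub y
    rw [sub_zero] at h2
    refine h2.congr fun t => ?_
    rcases le_total (x t) y with hxy | hxy
    · rw [min_eq_left hxy, max_eq_left (by linarith)]; ring
    · rw [min_eq_right hxy, max_eq_right (by linarith)]; ring
  have h3 : Tendsto (fun t => ν e (min (x t) y)) atTop (𝓝 (ν e y)) :=
    (hν.continuousOn e y hy).tendsto.comp (tendsto_nhdsWithin_iff.2
      ⟨h1, (eventually_ge_atTop 0).mono fun t ht => le_min (hx t ht) hy⟩)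
  filter_upwards [h3.eventually (lt_mem_nhds hb), eventually_ge_atTop 0] with t ht ht0
  exact ht.trans_le ((hν.strictMonoOn e).monotoneOn (le_min (hx t ht0) hy) (hx t ht0)
    (min_le_left _ _))

/-- Below total capacity, convergent inflows drive the densities to the equilibrium. -/
theorem IsNodeSolution.tendsto_flow_of_lt (hμ : IsFlowFamily μ) (hg : IsCooperativeRouting g)
    (ha : 0 ≤ a) {y : ι → ℝ} (hy : IsNodeEquilibrium μ g a y) {l : ℝ → ℝ} {x : ℝ → ι → ℝ}
    (hx : IsNodeSolution μ g l x) (hl : ∀ t, 0 ≤ t → 0 ≤ l t) (hla : Tendsto l atTop (𝓝 a))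
    (e : ι) : Tendsto (fun t => μ e (x t e)) atTop (𝓝 (μ e (y e))) := by
  have h1 : Tendsto (fun t => max (l t - a) 0) atTop (𝓝 0) := by
    simpa using (hla.sub_const a).max (tendsto_const_nhds (x := (0 : ℝ)))
  have h2 : Tendsto (fun t => max (a - l t) 0) atTop (𝓝 0) := by
    simpa using (hla.const_sub a).max (tendsto_const_nhds (x := (0 : ℝ)))
  have h3 := hx.tendsto_excess hμ hg hy ha h1 e
  have h4 := hx.tendsto_deficit hμ hg hy hl h2 e
  have h5 : Tendsto (fun t => x t e) atTop (𝓝 (y e)) := by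
    have h6 := (h3.sub h4).const_add (y e)
    rw [sub_zero, add_zero] at h6
    refine h6.congr fun t => ?_
    rcases le_total (x t e) (y e) with hxy | hxy
    · rw [max_eq_right (by linarith), max_eq_left (by linarith)]; ring
    · rw [max_eq_left (by linarith), max_eq_right (by linarith)]; ring
  exact (hμ.continuousOn e (y e) (hy.nonneg e)).tendsto.comp (tendsto_nhdsWithin_iff.2
    ⟨h5, (eventually_ge_atTop 0).mono fun t ht => hx.nonneg t ht e⟩)

/-- At or above total capacity, all links saturate: the solution asymptotically dominates the
equilibria for inflows slightly below total capacity. -/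
theorem IsNodeSolution.tendsto_flow_of_ge (hμ : IsFlowFamily μ) (hg : IsCooperativeRouting g)
    (hge : ∑ e, sSup (μ e '' Ici 0) ≤ a) {l : ℝ → ℝ} {x : ℝ → ι → ℝ}
    (hx : IsNodeSolution μ g l x) (hl : ∀ t, 0 ≤ t → 0 ≤ l t) (hla : Tendsto l atTop (𝓝 a))
    (e : ι) : Tendsto (fun t => μ e (x t e)) atTop (𝓝 (sSup (μ e '' Ici 0))) := by
  classical
  refine tendsto_order.2 ⟨fun b hb => ?_, fun b hb => ?_⟩
  · set C := ∑ e, sSup (μ e '' Ici 0) with hC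
    have hpos : ∀ e, 0 < sSup (μ e '' Ici 0) := fun e => by
      simpa only [hμ.zero e] using hμ.lt_sSup e le_rfl
    have := hg.nonempty
    have hC0 : 0 < C := Finset.sum_pos (fun e _ => hpos e) Finset.univ_nonempty
    obtain ⟨a', ha'1, ha'2⟩ := exists_between
      (max_lt hC0 (show C - (sSup (μ e '' Ici 0) - b) < C by linarith))
    have ha'0 := (le_max_left _ _).trans ha'1.le
    obtain ⟨y, hy⟩ := exists_isNodeEquilibrium hμ hg ha'0 ha'2
    have hby : b < μ e (y e) := by
      have h1 := hy.sum_flow hg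
      rw [← Finset.add_sum_erase _ _ (Finset.mem_univ e)] at h1 hC
      have h2 : ∑ j ∈ Finset.univ.erase e, μ j (y j)
          ≤ ∑ j ∈ Finset.univ.erase e, sSup (μ j '' Ici 0) :=
        Finset.sum_le_sum fun j _ => hμ.le_sSup j (hy.nonneg j)
      have h3 := (le_max_right _ _).trans_lt ha'1
      linarith
    refine hμ.eventually_lt_of_tendsto_deficit e (fun t ht => hx.nonneg t ht e) (hy.nonneg e)
      (hx.tendsto_deficit hμ hg hy hl ?_ e) hby
    refine tendsto_const_nhds.congr' ?_
    filter_upwards [hla.eventually (lt_mem_nhds (ha'2.trans_le hge))] with t ht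
    exact (max_eq_right (by linarith)).symm
  · filter_upwards [eventually_ge_atTop 0] with t ht
    exact (hμ.le_sSup e (hx.nonneg t ht e)).trans_lt hb

/-- Attractivity at one node: the limit flow is determined by the limit of the inflow, and it
saturates either all links or none. -/
theorem exists_node_limit (hμ : IsFlowFamily μ) (hg : IsCooperativeRouting g) (ha : 0 ≤ a) :
    ∃ φ : ι → ℝ, (∀ e, φ e ∈ Icc 0 (sSup (μ e '' Ici 0))) ∧
      ((∃ e, φ e = sSup (μ e '' Ici 0)) → ∀ e, φ e = sSup (μ e '' Ici 0)) ∧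
      ∀ (l : ℝ → ℝ) (x : ℝ → ι → ℝ), IsNodeSolution μ g l x → (∀ t, 0 ≤ t → 0 ≤ l t) →
        Tendsto l atTop (𝓝 a) → ∀ e, Tendsto (fun t => μ e (x t e)) atTop (𝓝 (φ e)) := by
  rcases lt_or_ge a (∑ e, sSup (μ e '' Ici 0)) with h | h
  · obtain ⟨y, hy⟩ := exists_isNodeEquilibrium hμ hg ha h
    exact ⟨fun e => μ e (y e),
      fun e => ⟨hμ.nonneg e (hy.nonneg e), hμ.le_sSup e (hy.nonneg e)⟩,
      fun ⟨e, he⟩ => absurd he (hμ.lt_sSup e (hy.nonneg e)).ne,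
      fun l x hx hl hla e => hx.tendsto_flow_of_lt hμ hg ha hy hl hla e⟩
  · exact ⟨fun e => sSup (μ e '' Ici 0),
      fun e => ⟨(hμ.nonneg e le_rfl).trans (hμ.le_sSup e le_rfl), le_rfl⟩, fun _ _ => rfl,
      fun l x hx hl hla e => hx.tendsto_flow_of_ge hμ hg h hl hla e⟩

end NodeEquilibrium

/-! ### Global solutions of ordinary differential equations -/

/-- A bounded vector field that is Lipschitz on every ball has a solution on `[0, ∞)` from every
initial point. -/
theorem exists_global_solution {X : Type*} [NormedAddCommGroup X] [NormedSpace ℝ X]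
    [CompleteSpace X] {F : X → X} {M : ℝ} (hM : ∀ x, ‖F x‖ ≤ M) (x₀ : X)
    (hF : ∀ R, ∃ K, LipschitzOnWith K F (Metric.closedBall x₀ R)) :
    ∃ α : ℝ → X, α 0 = x₀ ∧ ∀ t, 0 ≤ t → HasDerivWithinAt α (F (α t)) (Ici 0) t := by
  have hM0 : 0 ≤ M := (norm_nonneg _).trans (hM x₀)
  have hloc : ∀ n : ℕ, ∃ α : ℝ → X, α 0 = x₀ ∧
      ∀ t ∈ Icc (0 : ℝ) (n + 1), HasDerivWithinAt α (F (α t)) (Icc 0 (n + 1)) t := by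
    intro n
    have hn : (0 : ℝ) ≤ n + 1 := by positivity
    obtain ⟨K, hK⟩ := hF (M * (n + 1))
    -- The bound on the field confines the solution to a ball of radius `M * (n + 1)`.
    have hPL : IsPicardLindelof (fun _ : ℝ => F) (tmin := 0) (tmax := n + 1)
        ⟨0, le_rfl, hn⟩ x₀ ⟨M * (n + 1), mul_nonneg hM0 hn⟩ 0 ⟨M, hM0⟩ K :=
      { lipschitzOnWith := fun _ _ => hK
        continuousOn := fun _ _ => continuousOn_const
        norm_le := fun _ _ x _ => hM x
        mul_max_le := by
          simp only [sub_zero, sub_self, max_eq_left hn, NNReal.coe_zero]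
          exact le_rfl }
    exact hPL.exists_eq_forall_mem_Icc_hasDerivWithinAt₀
  choose α hα0 hα using hloc
  have huniq : ∀ m n : ℕ, m ≤ n → EqOn (α m) (α n) (Icc 0 (m + 1)) := by
    intro m n hmn
    have hsub : Icc (0 : ℝ) (m + 1) ⊆ Icc 0 (n + 1) := Icc_subset_Icc_right (by
      have : (m : ℝ) ≤ n := by exact_mod_cast hmn
      linarith)
    have hcm : ContinuousOn (α m) (Icc 0 (m + 1)) := fun t ht => (hα m t ht).continuousWithinAt
    have hcn : ContinuousOn (α n) (Icc 0 (m + 1)) := fun t ht =>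
      (hα n t (hsub ht)).continuousWithinAt.mono hsub
    obtain ⟨R, hR⟩ := ((isCompact_Icc.image_of_continuousOn hcm).union
      (isCompact_Icc.image_of_continuousOn hcn)).isBounded.subset_closedBall x₀
    obtain ⟨K, hK⟩ := hF R
    refine ODE_solution_unique_of_mem_Icc_right (v := fun _ => F) (K := K)
      (s := fun _ => Metric.closedBall x₀ R) (fun _ _ => hK) hcm (fun t ht => ?_) (fun t ht =>
      hR (Or.inl (mem_image_of_mem _ (Ico_subset_Icc_self ht)))) hcn (fun t ht => ?_)
      (fun t ht => hR (Or.inr (mem_image_of_mem _ (Ico_subset_Icc_self ht))))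
      ((hα0 m).trans (hα0 n).symm)
    · exact (hα m t (Ico_subset_Icc_self ht)).mono_of_mem_nhdsWithin
        (mem_of_superset (Icc_mem_nhdsGE ht.2) (Icc_subset_Icc_left ht.1))
    · have ht' := hsub (Ico_subset_Icc_self ht)
      exact ((hα n t ht').mono hsub).mono_of_mem_nhdsWithin
        (mem_of_superset (Icc_mem_nhdsGE ht.2) (Icc_subset_Icc_left ht.1))
  refine ⟨fun t => α ⌊t⌋₊ t, by simpa using hα0 0, fun t ht => ?_⟩
  have htn : t < ⌊t⌋₊ + 1 := Nat.lt_floor_add_one t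
  have hnhds : Icc (0 : ℝ) (⌊t⌋₊ + 1) ∈ 𝓝[Ici 0] t :=
    mem_of_superset (inter_mem_nhdsWithin _ (Iic_mem_nhds htn)) (fun s hs => hs)
  refine ((hα ⌊t⌋₊ t ⟨ht, htn.le⟩).mono_of_mem_nhdsWithin hnhds).congr_of_eventuallyEq ?_ rfl
  filter_upwards [inter_mem_nhdsWithin (Ici (0 : ℝ)) (Iio_mem_nhds htn)] with s hs
  refine huniq _ _ ?_ ⟨hs.1, (Nat.lt_floor_add_one s).le⟩
  rw [← Nat.lt_succ_iff, Nat.floor_lt hs.1]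
  exact_mod_cast hs.2

/-! ### The network -/

/-- Without directed cycles the links of a finite network order the nodes well-foundedly, so that
statements can be proved node by node, each node after its predecessors. -/
theorem DirMultigraph.IsOriginDestination.wellFounded_link {V E : Type*} [Finite V]
    {T : DirMultigraph V E} {o d : V} (hT : T.IsOriginDestination o d) : WellFounded T.Link := by
  have h1 : IsTrans V (Relation.TransGen T.Link) := ⟨fun _ _ _ => Relation.TransGen.trans⟩
  have h2 : Std.Irrefl (Relation.TransGen T.Link) := ⟨hT.acyclic⟩
  exact Subrelation.wf (fun h => Relation.TransGen.single h)
    (Finite.wellFounded_of_trans_of_irrefl (Relation.TransGen T.Link))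

section Routing

variable {V E : Type*} [Fintype E] [DecidableEq E] [DecidableEq V]
  {T : DirMultigraph V E} {d : V} {G : LocalRouting T}

theorem IsLocallyResponsive.le_update (hG : IsLocallyResponsive T d G) {v : V} (hv : v ≠ d)
    {j e : T.Out v} (hje : j ≠ e) {ρ : T.Out v → ℝ} (hρ : 0 ≤ ρ) {s : ℝ} (hs : ρ e ≤ s) :
    G v ρ j ≤ G v (Function.update ρ e s) j := by
  have hmaps : MapsTo (fun x => Function.update ρ e x) (Ici 0) (Ici 0) := fun x hx =>
    le_update_iff.2 ⟨hx, fun i _ => hρ i⟩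
  have hC : ContDiffOn ℝ 1 (fun x => G v (Function.update ρ e x) j) (Ici 0) :=
    (contDiffOn_pi.1 (hG.contDiffOn v hv) j).comp (contDiff_update 1 ρ e).contDiffOn hmaps
  have hmono : MonotoneOn (fun x => G v (Function.update ρ e x) j) (Ici 0) := by
    refine monotoneOn_of_deriv_nonneg (convex_Ici 0) hC.continuousOn
      ((hC.differentiableOn one_ne_zero).mono interior_subset) fun x hx => ?_
    have hx0 : (0 : ℝ) ≤ x := interior_subset (s := Ici (0 : ℝ)) hx
    have h := hG.partial_nonneg v hv j e hje (Function.update ρ e x) (hmaps hx0)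
    simp only [Function.update_idem, Function.update_self] at h
    rwa [derivWithin_of_mem_nhds (mem_interior_iff_mem_nhds.1 hx)] at h
  simpa using hmono (mem_Ici.2 (hρ e)) (mem_Ici.2 ((hρ e).trans hs)) hs

theorem IsLocallyResponsive.mono (hG : IsLocallyResponsive T d G) {v : V} (hv : v ≠ d)
    {x y : T.Out v → ℝ} (hx : 0 ≤ x) (hxy : x ≤ y) (j : T.Out v) (hj : x j = y j) :
    G v x j ≤ G v y j := by
  have key : ∀ A : Finset (T.Out v), j ∉ A → G v x j ≤ G v (A.piecewise y x) j := by
    intro A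
    induction A using Finset.induction_on with
    | empty => intro _; simp
    | insert e A he ih =>
      intro hjA
      rw [Finset.mem_insert, not_or] at hjA
      rw [Finset.piecewise_insert]
      refine (ih hjA.2).trans (hG.le_update hv hjA.1 ?_ ?_)
      · exact hx.trans (Finset.le_piecewise_of_le_of_le A hxy le_rfl)
      · rw [Finset.piecewise_eq_of_notMem _ _ _ he]
        exact hxy e
  have h := key (Finset.univ.erase j) (Finset.notMem_erase j _)
  have hy : (Finset.univ.erase j).piecewise y x = y := by
    funext e
    by_cases he : e = j
    · subst he
      rw [Finset.piecewise_eq_of_notMem _ _ _ (Finset.notMem_erase _ _), hj]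
    · rw [Finset.piecewise_eq_of_mem _ _ _ (Finset.mem_erase.2 ⟨he, Finset.mem_univ e⟩)]
  rwa [hy] at h

theorem IsLocallyResponsive.isCooperativeRouting (hG : IsLocallyResponsive T d G) {v : V}
    (hv : v ≠ d) : IsCooperativeRouting (G v) where
  mapsTo := hG.mapsTo v hv
  continuousOn := (hG.contDiffOn v hv).continuousOn
  mono := fun x y hx hxy j hj => hG.mono hv hx hxy j hj
  escape := by
    intro J hJ hJ' s u hu hout hin e he
    obtain ⟨GJ, -, -, h⟩ := hG.limit v hv J hJ hJ'
    have hs : (0 : J → ℝ) ≤ fun j : J => s j := fun j =>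
      ge_of_tendsto' (hin j j.2) fun n => hu n j
    exact (h (fun j : J => s j) hs (map u atTop) (eventually_map.2 (Eventually.of_forall hu))
      (fun e he => tendsto_map'_iff.2 (hout e he))
      (fun j => tendsto_map'_iff.2 (hin j j.2))).1 e he

end Routing

namespace FlowNetwork

variable {V E : Type*} {N : FlowNetwork V E}

theorem RegularFlow.isFlowFamily (hμ : N.RegularFlow) {κ : Type*} (i : κ → E) :
    IsFlowFamily fun k => N.μ (i k) where
  continuousOn := fun k => (hμ.contDiffOn (i k)).continuousOn
  strictMonoOn := fun k => hμ.strictMonoOn (i k)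
  zero := fun k => hμ.zero (i k)
  bddAbove := fun k => hμ.bddAbove (i k)

theorem RegularFlow.closure_admissible (hμ : N.RegularFlow) :
    closure N.admissible = Set.pi univ fun e => Icc 0 (N.fmax e) := by
  have h : ∀ e, (0 : ℝ) ≠ N.fmax e := fun e => by
    have := (hμ.isFlowFamily id).lt_sSup e le_rfl
    simp only [id, hμ.zero e] at this
    exact this.ne
  simp only [admissible, closure_pi_set, closure_Ico (h _)]

theorem tail_ne_destination {o d : V} (hT : N.IsOriginDestination o d) (e : E) : N.tail e ≠ d :=
  (hT.destination_iff d).2 rfl e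

variable [Fintype E] [DecidableEq V] {o d : V} {lam : ℝ} {G : LocalRouting N.toDirMultigraph}

theorem inflow_nonneg (hlam : 0 ≤ lam) {ρ : E → ℝ} (hρ : 0 ≤ ρ) (v : V) :
    0 ≤ N.inflow o lam ρ v := by
  unfold inflow
  split_ifs
  · exact hlam
  · exact Finset.sum_nonneg fun e _ => N.μ_nonneg e _ (hρ e)

theorem IsSolution.isNodeSolution {ρ₀ : E → ℝ} {ρ : ℝ → E → ℝ} (h : N.IsSolution o lam G ρ₀ ρ)
    (v : V) : IsNodeSolution (fun e : N.Out v => N.μ e) (G v)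
      (fun t => N.inflow o lam (ρ t) v) (fun t e => ρ t e) where
  nonneg := fun t ht e => h.nonneg t ht e
  ode := by
    rintro t ht ⟨e, rfl⟩
    exact h.ode t ht e

variable [DecidableEq E]

/-- Two solutions agree, node by node: once they agree on the links entering a node, the inflows
at this node agree, and the comparison principle applies in both directions. -/
theorem IsSolution.eqOn [Finite V] (hT : N.IsOriginDestination o d) (hμ : N.RegularFlow)
    (hlam : 0 ≤ lam) (hG : IsLocallyResponsive N.toDirMultigraph d G) {ρ₀ : E → ℝ}
    {ρ ρ' : ℝ → E → ℝ} (h : N.IsSolution o lam G ρ₀ ρ) (h' : N.IsSolution o lam G ρ₀ ρ') :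
    EqOn ρ ρ' (Ici 0) := by
  have key : ∀ v : V, ∀ t, 0 ≤ t → ∀ e : N.Out v, ρ t e = ρ' t e := by
    intro v
    induction v using hT.wellFounded_link.induction with
    | _ v ih =>
      intro t ht e
      have hv : v ≠ d := e.2 ▸ tail_ne_destination hT e.1
      have hin : ∀ t, 0 ≤ t → N.inflow o lam (ρ t) v = N.inflow o lam (ρ' t) v := by
        intro t ht
        unfold inflow
        split_ifs
        · rfl
        · refine Finset.sum_congr rfl fun i hi => ?_
          have := ih (N.tail i) ⟨i, rfl, (Finset.mem_filter.1 hi).2⟩ t ht ⟨i, rfl⟩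
          simp only [flow, this]
      have h0 : ρ 0 = ρ' 0 := h.init.trans h'.init.symm
      have hμ' := hμ.isFlowFamily (fun e : N.Out v => (e : E))
      have hg := hG.isCooperativeRouting hv
      exact le_antisymm
        ((h.isNodeSolution v).le hμ' hg (h'.isNodeSolution v)
          (fun t ht => inflow_nonneg hlam (h'.nonneg t ht) v) (fun t ht => (hin t ht).le)
          (fun e => (congrFun h0 e).le) ht e)
        ((h'.isNodeSolution v).le hμ' hg (h.isNodeSolution v)
          (fun t ht => inflow_nonneg hlam (h.nonneg t ht) v) (fun t ht => (hin t ht).ge)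
          (fun e => (congrFun h0 e).ge) ht e)
  intro t ht
  funext e
  exact key (N.tail e) t ht ⟨e, rfl⟩

/-- The right-hand side of the dynamics, as a vector field on density vectors. -/
noncomputable def velocity (N : FlowNetwork V E) (o : V) (lam : ℝ)
    (G : LocalRouting N.toDirMultigraph) (ρ : E → ℝ) : E → ℝ := fun e =>
  N.inflow o lam ρ (N.tail e) * G (N.tail e) (fun j => ρ j) ⟨e, rfl⟩ - N.flow ρ e

theorem contDiffOn_velocity (hT : N.IsOriginDestination o d) (hμ : N.RegularFlow)
    (hG : IsLocallyResponsive N.toDirMultigraph d G) :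
    ContDiffOn ℝ 1 (N.velocity o lam G) (Ici 0) := by
  have hflow : ∀ e, ContDiffOn ℝ 1 (fun ρ : E → ℝ => N.flow ρ e) (Ici 0) := fun e =>
    (hμ.contDiffOn e).comp (contDiff_apply ℝ ℝ e).contDiffOn fun ρ hρ => hρ e
  have hinflow : ∀ v, ContDiffOn ℝ 1 (fun ρ : E → ℝ => N.inflow o lam ρ v) (Ici 0) := fun v => by
    unfold inflow
    split_ifs
    · exact contDiffOn_const
    · exact ContDiffOn.sum fun e _ => hflow e
  refine contDiffOn_pi.2 fun e => ((hinflow _).mul ?_).sub (hflow e)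
  have hres : ContDiff ℝ 1 fun (ρ : E → ℝ) (j : N.Out (N.tail e)) => ρ j :=
    contDiff_pi.2 fun j => contDiff_apply ℝ ℝ (j : E)
  exact (contDiffOn_pi.1 (hG.contDiffOn _ (tail_ne_destination hT e)) ⟨e, rfl⟩).comp
    hres.contDiffOn fun ρ hρ j => hρ j

theorem norm_velocity_le (hT : N.IsOriginDestination o d) (hμ : N.RegularFlow) (hlam : 0 ≤ lam)
    (hG : IsLocallyResponsive N.toDirMultigraph d G) {ρ : E → ℝ} (hρ : 0 ≤ ρ) :
    ‖N.velocity o lam G ρ‖ ≤ lam + ∑ e, N.fmax e := by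
  have hμ' := hμ.isFlowFamily id
  have hle : ∀ e, N.flow ρ e ≤ N.fmax e := fun e => hμ'.le_sSup e (hρ e)
  have h0 : ∀ e, 0 ≤ N.flow ρ e := fun e => N.μ_nonneg e _ (hρ e)
  have hsum : ∀ A : Finset E, ∑ e ∈ A, N.flow ρ e ≤ ∑ e, N.fmax e := fun A =>
    (Finset.sum_le_sum_of_subset_of_nonneg (Finset.subset_univ A) fun e _ _ => h0 e).trans
      (Finset.sum_le_sum fun e _ => hle e)
  have hsum0 : 0 ≤ ∑ e, N.fmax e := (Finset.sum_nonneg fun e _ => h0 e).trans (hsum Finset.univ)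
  refine (pi_norm_le_iff_of_nonneg (add_nonneg hlam hsum0)).2 fun e => ?_
  have hin0 := N.inflow_nonneg (o := o) hlam hρ (N.tail e)
  have hin : N.inflow o lam ρ (N.tail e) ≤ lam + ∑ e, N.fmax e := by
    unfold inflow
    split_ifs
    · linarith
    · linarith [hsum (Finset.univ.filter fun i => N.head i = N.tail e)]
  have hG' := mem_Icc_of_mem_stdSimplex (hG.mapsTo _ (tail_ne_destination hT e)
    (show (0 : N.Out (N.tail e) → ℝ) ≤ fun j : N.Out (N.tail e) => ρ j from fun j => hρ j))
    ⟨e, rfl⟩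
  have h1 := mul_nonneg hin0 hG'.1
  have h2 := mul_le_of_le_one_right hin0 hG'.2
  have h3 : N.flow ρ e ≤ ∑ e, N.fmax e := by simpa using hsum {e}
  rw [Real.norm_eq_abs, abs_le]
  constructor <;> simp only [velocity] <;> linarith [h0 e]

/-- Solutions exist globally: the velocity field, composed with the projection onto the
nonnegative orthant, is bounded and locally Lipschitz, and its solutions stay in the orthant
because no component decreases where it is nonpositive. -/
theorem exists_isSolution (hT : N.IsOriginDestination o d) (hμ : N.RegularFlow) (hlam : 0 ≤ lam)
    (hG : IsLocallyResponsive N.toDirMultigraph d G) {ρ₀ : E → ℝ} (hρ₀ : 0 ≤ ρ₀) :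
    ∃ ρ, N.IsSolution o lam G ρ₀ ρ := by
  have hpos : ∀ ρ : E → ℝ, 0 ≤ ρ ⊔ 0 := fun ρ => le_sup_right
  have hproj : LipschitzWith 1 fun ρ : E → ℝ => ρ ⊔ 0 := LipschitzWith.of_dist_le_mul
    fun ρ σ => by
      rw [NNReal.coe_one, one_mul, dist_pi_le_iff dist_nonneg]
      intro e
      refine le_trans ?_ (dist_le_pi_dist ρ σ e)
      simp only [Real.dist_eq, Pi.sup_apply, Pi.zero_apply]
      exact abs_max_sub_max_le_abs _ _ _
  have hlip : ∀ R, ∃ K, LipschitzOnWith K (fun ρ : E → ℝ => N.velocity o lam G (ρ ⊔ 0))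
      (Metric.closedBall ρ₀ R) := by
    intro R
    set b : E → ℝ := fun e => |ρ₀ e| + |R| with hb_def
    have hb : ∀ ρ ∈ Metric.closedBall ρ₀ R, ρ ⊔ 0 ≤ b := fun ρ hρ e => by
      have h1 := (dist_le_pi_dist ρ ρ₀ e).trans (Metric.mem_closedBall.1 hρ)
      rw [Real.dist_eq] at h1
      refine max_le ?_ (by positivity)
      linarith [le_abs_self (ρ e - ρ₀ e), le_abs_self (ρ₀ e), le_abs_self R]
    obtain ⟨K, hK⟩ := ((contDiffOn_velocity (lam := lam) hT hμ hG).mono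
      (Icc_subset_Ici_self : Icc 0 b ⊆ Ici 0)).exists_lipschitzOnWith one_ne_zero
      (convex_Icc 0 b) isCompact_Icc
    exact ⟨K * 1, hK.comp (hproj.lipschitzOnWith (s := Metric.closedBall ρ₀ R)) fun ρ hρ =>
      ⟨hpos ρ, hb ρ hρ⟩⟩
  obtain ⟨ρ, hρ0, hρ⟩ := exists_global_solution
    (fun ρ => norm_velocity_le hT hμ hlam hG (hpos ρ)) ρ₀ hlip
  have hρe : ∀ t, 0 ≤ t → ∀ e, HasDerivWithinAt (fun s => ρ s e)
      (N.velocity o lam G (ρ t ⊔ 0) e) (Ici 0) t := fun t ht => hasDerivWithinAt_pi.1 (hρ t ht)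
  have hnonneg : ∀ t, 0 ≤ t → 0 ≤ ρ t := by
    intro t ht e
    have hvel : ∀ s, ρ s e ≤ 0 → 0 ≤ N.velocity o lam G (ρ s ⊔ 0) e := fun s hs => by
      have h1 : N.flow (ρ s ⊔ 0) e = 0 := by
        simp only [flow, Pi.sup_apply, Pi.zero_apply, sup_eq_right.2 hs, hμ.zero e]
      have h2 := (hG.mapsTo _ (tail_ne_destination hT e)
        (show (0 : N.Out (N.tail e) → ℝ) ≤ fun j : N.Out (N.tail e) => (ρ s ⊔ 0) j from
          fun j => hpos (ρ s) j)).1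
        ⟨e, rfl⟩
      have h3 := mul_nonneg (N.inflow_nonneg (o := o) hlam (hpos (ρ s)) (N.tail e)) h2
      simp only [velocity, h1, sub_zero]
      exact h3
    have hle := image_le_of_deriv_right_le_deriv_boundary (a := 0) (b := t)
      (f := fun s => max (-ρ s e) 0) (B := fun _ => 0) (B' := fun _ => 0)
      (ContinuousOn.sup (fun s hs => ((hρe s hs.1 e).continuousWithinAt.mono
        Icc_subset_Ici_self).neg) continuousOn_const)
      (fun s hs => hasDerivWithinAt_posPart ((hρe s hs.1 e).neg.mono (Ici_subset_Ici.2 hs.1)))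
      (by simpa [hρ0] using hρ₀ e) continuousOn_const (fun s _ => hasDerivWithinAt_const _ _ _)
      (fun s hs => ?_) ⟨ht, le_rfl⟩
    · have := (le_max_left (-ρ t e) 0).trans hle
      simpa using this
    · split_ifs with h
      · have : ρ s e ≤ 0 := by rcases h with h | h <;> linarith [h]
        linarith [hvel s this]
      · exact le_rfl
  refine ⟨ρ, hρ0, hnonneg, fun t ht e => ?_⟩
  have h := hρe t ht e
  rw [sup_eq_left.2 (hnonneg t ht)] at h
  exact h

/-- Propagation of the limit along the network, node by node: the limits of the flows entering a
node determine the limit of its inflow, hence the limits of the flows leaving it. -/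
theorem exists_limit_at_node [Finite V] (hT : N.IsOriginDestination o d) (hμ : N.RegularFlow)
    (hlam : 0 ≤ lam) (hG : IsLocallyResponsive N.toDirMultigraph d G) (v : V) :
    ∃ φ : N.Out v → ℝ, (∀ e : N.Out v, φ e ∈ Icc 0 (N.fmax e)) ∧
      ((∃ e : N.Out v, φ e = N.fmax e) → ∀ e : N.Out v, φ e = N.fmax e) ∧
      ∀ (ρ₀ : E → ℝ) (ρ : ℝ → E → ℝ), N.IsSolution o lam G ρ₀ ρ →
        ∀ e : N.Out v, Tendsto (fun t => N.flow (ρ t) e) atTop (𝓝 (φ e)) := by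
  induction v using hT.wellFounded_link.induction with
  | _ v ih =>
    by_cases hv : v = d
    · have hempty : ∀ e : N.Out v, False := fun e => tail_ne_destination hT e.1 (e.2.trans hv)
      exact ⟨fun _ => 0, fun e => (hempty e).elim, fun _ e => (hempty e).elim,
        fun _ _ _ e => (hempty e).elim⟩
    choose φ hφmem _ hφ using ih
    obtain ⟨a, ha, hlim⟩ : ∃ a, 0 ≤ a ∧ ∀ (ρ₀ : E → ℝ) (ρ : ℝ → E → ℝ),
        N.IsSolution o lam G ρ₀ ρ →
          Tendsto (fun t => N.inflow o lam (ρ t) v) atTop (𝓝 a) := by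
      by_cases hvo : v = o
      · refine ⟨lam, hlam, fun ρ₀ ρ _ => ?_⟩
        simp only [inflow, if_pos hvo]
        exact tendsto_const_nhds
      · have hlink : ∀ e : {e : E // N.head e = v}, N.Link (N.tail e) v := fun e => ⟨e, rfl, e.2⟩
        refine ⟨∑ e : {e : E // N.head e = v}, φ _ (hlink e) ⟨e, rfl⟩,
          Finset.sum_nonneg fun e _ => (hφmem _ (hlink e) _).1, fun ρ₀ ρ h => ?_⟩
        have hsum : ∀ t, N.inflow o lam (ρ t) v
            = ∑ e : {e : E // N.head e = v}, N.flow (ρ t) e := fun t => by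
          rw [inflow, if_neg hvo]
          exact Finset.sum_subtype _ (by simp) _
        simp only [hsum]
        exact tendsto_finsetSum _ fun e _ => hφ _ (hlink e) ρ₀ ρ h ⟨e, rfl⟩
    obtain ⟨ψ, hψmem, hψsat, hψ⟩ := exists_node_limit
      (hμ.isFlowFamily fun e : N.Out v => (e : E)) (hG.isCooperativeRouting hv) ha
    exact ⟨ψ, hψmem, hψsat, fun ρ₀ ρ h => hψ _ _ (h.isNodeSolution v)
      (fun t ht => inflow_nonneg hlam (h.nonneg t ht) v) (hlim ρ₀ ρ h)⟩

end FlowNetwork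

/-- For every initial density vector the dynamical flow network has exactly one solution on
`[0, ∞)`; there is exactly one globally attractive limit flow; and if the limit flow saturates
one link leaving a nondestination node, it saturates every link leaving that node. -/
theorem theorem1 {V E : Type*} [Fintype V] [Fintype E] [DecidableEq V] [DecidableEq E]
    (N : FlowNetwork V E) (o d : V) (hT : N.IsOriginDestination o d) (hμ : N.RegularFlow)
    (lam : ℝ) (hlam : 0 ≤ lam) (G : LocalRouting N.toDirMultigraph)
    (hG : IsLocallyResponsive N.toDirMultigraph d G) :
    (∀ ρ₀ : E → ℝ, 0 ≤ ρ₀ → ∃ ρ : ℝ → E → ℝ, N.IsSolution o lam G ρ₀ ρ ∧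
      ∀ ρ' : ℝ → E → ℝ, N.IsSolution o lam G ρ₀ ρ' → EqOn ρ' ρ (Ici 0)) ∧
    (∃! f : E → ℝ, N.IsLimitFlow o lam G f) ∧
    (∀ f : E → ℝ, N.IsLimitFlow o lam G f → ∀ v : V, v ≠ d →
      (∃ e : E, N.tail e = v ∧ f e = N.fmax e) →
        ∀ e : E, N.tail e = v → f e = N.fmax e) := by
  have hex : ∀ ρ₀ : E → ℝ, 0 ≤ ρ₀ → ∃ ρ, N.IsSolution o lam G ρ₀ ρ := fun ρ₀ hρ₀ =>
    FlowNetwork.exists_isSolution hT hμ hlam hG hρ₀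
  choose φ hφmem hφsat hφ using FlowNetwork.exists_limit_at_node hT hμ hlam hG
  have hlimit : N.IsLimitFlow o lam G fun e => φ (N.tail e) ⟨e, rfl⟩ := by
    refine ⟨?_, fun ρ₀ _ ρ hρ => tendsto_pi_nhds.2 fun e => hφ _ ρ₀ ρ hρ ⟨e, rfl⟩⟩
    rw [hμ.closure_admissible]
    exact fun e _ => hφmem _ ⟨e, rfl⟩
  have huniq : ∀ f, N.IsLimitFlow o lam G f → f = fun e => φ (N.tail e) ⟨e, rfl⟩ := by
    intro f hf
    obtain ⟨ρ, hρ⟩ := hex 0 le_rfl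
    exact tendsto_nhds_unique (hf.2 0 le_rfl ρ hρ) (hlimit.2 0 le_rfl ρ hρ)
  refine ⟨fun ρ₀ hρ₀ => ?_, ⟨_, hlimit, huniq⟩, ?_⟩
  · obtain ⟨ρ, hρ⟩ := hex ρ₀ hρ₀
    exact ⟨ρ, hρ, fun ρ' hρ' => hρ'.eqOn hT hμ hlam hG hρ⟩
  · intro f hf v _ hsat e he
    obtain ⟨i, rfl, hi⟩ := hsat
    rw [huniq f hf] at hi
    have key : ∀ (v : V) (e : E) (he : N.tail e = v),
        φ (N.tail e) ⟨e, rfl⟩ = φ v ⟨e, he⟩ := by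
      rintro _ e rfl
      rfl
    rw [huniq f hf]
    exact (key _ e he).trans (hφsat (N.tail i) ⟨(⟨i, rfl⟩ : N.Out (N.tail i)), hi⟩ ⟨e, he⟩)
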